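/- Let $\Gamma$ be a torsionless grading monoid, that is, a commutative cancellative monoid (written additively) whose quotient group is torsion-free, and let $R=\bigoplus_{\alpha\in\Gamma}R_\alpha$ be a $\Gamma$-graded integral domain with quotient field $K$. Let $H$ be the set of nonzero homogeneous elements of $R$, and let $R_H=\{a/h : a\in R,\ h\in H\}\subseteq K$. A semistar operation on $R$ is a map $E\mapsto E^\star$ from the set of nonzero $R$-submodules of $K$ to itself such that, for all $0\neq x\in K$ and all nonzero $R$-submodules $E,F$ of $K$: $(xE)^\star=xE^\star$; $E\subseteq F$ implies $E^\star\subseteq F^\star$; $E\subseteq E^\star$; and $(E^\star)^\star=E^\star$. For $a\in R$ let $C(a)$ be the ideal of $R$ generated by the homogeneous components of $a$, and for $f=f_0+f_1X+\cdots+f_mX^m\in R[X]$ let $\mathcal{A}_f=\sum_{i=0}^m C(f_i)$. Given a semistar operation $\star$ on $R$, the set $$N(\star)=\{f\in R[X] : f\neq 0 \text{ and } \mathcal{A}_f^\star=R^\star\}$$ is multiplicatively closed; put $\mathrm{NA}(R,\star)=R[X]_{N(\star)}$. **Theorem.** Let $\star$ be a semistar operation on $R$ such that $R^\star\subsetneq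 R_H$. Then every invertible ideal $A$ of $\mathrm{NA}(R,\star)$ is principal. More precisely, $A$ is generated by finitely many polynomials $f_1,\dots,f_n\in R[X]$, and whenever $A=(f_1,\dots,f_n)\,\mathrm{NA}(R,\star)$ with $f_1,\dots,f_n\in R[X]$, then $A=f\,\mathrm{NA}(R,\star)$ for $$f=f_1+f_2X^{\deg f_1+1}+\cdots+f_nX^{\deg f_1+\cdots+\deg f_{n-1}+n-1},$$ where $\deg 0$ is taken to be $0$. -/

import Mathlib

open Polynomial
open scoped Pointwise nonZeroDivisors

/-! ### Semistar operations -/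

section Semistar

variable (R K : Type*) [CommRing R] [Field K] [Algebra R K]

/-- The set of all nonzero `R`-submodules of `K` (in the applications `R` is an integral domain
and `K` is its quotient field). -/
abbrev NonzeroSubmodule : Type _ := {E : Submodule R K // E ≠ ⊥}

variable {R K}

/-- The submodule `xE`, for `0 ≠ x ∈ K` and a nonzero `R`-submodule `E` of `K`. -/
def NonzeroSubmodule.scale (x : K) (hx : x ≠ 0) (E : NonzeroSubmodule R K) :
    NonzeroSubmodule R K :=
  ⟨x • E.1, by
    obtain ⟨y, hy, hy0⟩ := (Submodule.ne_bot_iff _).1 E.2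
    exact (Submodule.ne_bot_iff _).2
      ⟨x • y, Submodule.smul_mem_pointwise_smul _ _ _ hy, smul_ne_zero hx hy0⟩⟩

variable (R K)

/-- A semistar operation on the domain `R` with quotient field `K`. -/
structure SemistarOperation where
  /-- the map `E ↦ E^⋆` on nonzero `R`-submodules of `K` -/
  star : NonzeroSubmodule R K → NonzeroSubmodule R K
  star_scale : ∀ (x : K) (hx : x ≠ 0) (E : NonzeroSubmodule R K),
    star (E.scale x hx) = (star E).scale x hx
  star_mono : ∀ E F : NonzeroSubmodule R K, E ≤ F → star E ≤ star F
  le_star : ∀ E : NonzeroSubmodule R K, E ≤ star E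
  star_star : ∀ E : NonzeroSubmodule R K, star (star E) = star E

variable [IsFractionRing R K]

variable {R} in
/-- A nonzero ideal of `R`, regarded as a nonzero `R`-submodule of `K`. -/
def nonzeroSubmoduleOfIdeal (I : Ideal R) (hI : I ≠ ⊥) : NonzeroSubmodule R K :=
  ⟨IsLocalization.coeSubmodule K I, by
    obtain ⟨y, hy, hy0⟩ := (Submodule.ne_bot_iff _).1 hI
    refine (Submodule.ne_bot_iff _).2 ⟨algebraMap R K y, ⟨y, hy, rfl⟩, fun h => hy0 ?_⟩
    exact IsFractionRing.injective R K (by simpa using h)⟩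

/-- The ring `R` itself, regarded as a nonzero `R`-submodule of `K`. -/
def nonzeroSubmoduleSelf : NonzeroSubmodule R K :=
  ⟨1, (Submodule.ne_bot_iff _).2 ⟨1, Submodule.one_le.1 le_rfl, one_ne_zero⟩⟩

variable {R K}

/-- `I^⋆ = R^⋆` for a nonzero ideal `I` (only an auxiliary notion, used to show below that
`N(⋆)` is multiplicatively closed). -/
def StarDense (s : SemistarOperation R K) (I : Ideal R) : Prop :=
  ∃ hI : I ≠ ⊥, s.star (nonzeroSubmoduleOfIdeal K I hI) = s.star (nonzeroSubmoduleSelf R K)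

theorem ofIdeal_le_self (I : Ideal R) (hI : I ≠ ⊥) :
    nonzeroSubmoduleOfIdeal K I hI ≤ nonzeroSubmoduleSelf R K := by
  change IsLocalization.coeSubmodule K I ≤ (1 : Submodule R K)
  rw [← IsLocalization.coeSubmodule_top]
  exact IsLocalization.coeSubmodule_mono K le_top

theorem StarDense.mono {s : SemistarOperation R K} {I J : Ideal R} (h : StarDense s I)
    (hIJ : I ≤ J) : StarDense s J := by
  obtain ⟨hI, h⟩ := h
  have hJ : J ≠ ⊥ := fun hJ => hI (le_bot_iff.1 (hJ ▸ hIJ))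
  refine ⟨hJ, le_antisymm (s.star_mono _ _ (ofIdeal_le_self J hJ)) ?_⟩
  rw [← h]
  exact s.star_mono _ _ (IsLocalization.coeSubmodule_mono K hIJ)

theorem StarDense.mul [IsDomain R] {s : SemistarOperation R K} {I J : Ideal R}
    (hI : StarDense s I) (hJ : StarDense s J) : StarDense s (I * J) := by
  obtain ⟨hI0, hI⟩ := hI
  obtain ⟨hJ0, hJ⟩ := hJ
  have h0 : I * J ≠ ⊥ := mul_ne_zero hI0 hJ0
  refine ⟨h0, le_antisymm (s.star_mono _ _ (ofIdeal_le_self _ h0)) ?_⟩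
  rw [← hI, ← s.star_star (nonzeroSubmoduleOfIdeal K (I * J) h0)]
  refine s.star_mono _ _ ?_
  rintro _ ⟨x, hx, rfl⟩
  by_cases hx0 : (Algebra.linearMap R K) x = 0
  · rw [hx0]; exact Submodule.zero_mem _
  have h1 : (nonzeroSubmoduleOfIdeal K J hJ0).scale _ hx0 ≤
      nonzeroSubmoduleOfIdeal K (I * J) h0 := by
    rintro _ ⟨_, ⟨y, hy, rfl⟩, rfl⟩
    exact ⟨x * y, Ideal.mul_mem_mul hx hy, by simp⟩
  have h2 := s.star_mono _ _ h1
  rw [s.star_scale, hJ] at h2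
  have h3 : (1 : K) ∈ (s.star (nonzeroSubmoduleSelf R K)).1 :=
    s.le_star _ (Submodule.one_le.1 le_rfl)
  have h4 := h2 (Submodule.smul_mem_pointwise_smul _ (Algebra.linearMap R K x) _ h3)
  simpa using h4

theorem StarDense.top [Nontrivial R] (s : SemistarOperation R K) : StarDense s ⊤ := by
  refine ⟨top_ne_bot, congrArg s.star (Subtype.ext ?_)⟩
  exact IsLocalization.coeSubmodule_top K

theorem StarDense.pow [IsDomain R] {s : SemistarOperation R K} {I : Ideal R}
    (hI : StarDense s I) (n : ℕ) : StarDense s (I ^ n) := by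
  induction n with
  | zero => simpa using StarDense.top s
  | succ n ih => rw [pow_succ]; exact ih.mul hI

end Semistar

/-! ### Graded integral domains -/

section Graded

variable {Γ R : Type*} [AddCancelCommMonoid Γ] [DecidableEq Γ] [CommRing R]
  (𝒜 : Γ → AddSubgroup R) [GradedRing 𝒜]

/-- `C(a)`: the ideal generated by the homogeneous components of `a`. -/
def homogeneousContent (a : R) : Ideal R :=
  Ideal.span (Set.range fun γ : Γ => (DirectSum.decompose 𝒜 a γ : R))

/-- `A_f = ∑ᵢ C(fᵢ)`: the homogeneous content ideal of `f = ∑ᵢ fᵢ Xⁱ`. The sum is written as a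
supremum over all `i`, where all but finitely many terms are `C(0) = 0`. -/
def homogeneousContentIdeal (f : R[X]) : Ideal R :=
  ⨆ i : ℕ, homogeneousContent 𝒜 (f.coeff i)

theorem homogeneousContent_le_iff {a : R} {I : Ideal R} (hI : I.IsHomogeneous 𝒜) :
    homogeneousContent 𝒜 a ≤ I ↔ a ∈ I := by
  constructor
  · intro h
    classical
    rw [← DirectSum.sum_support_decompose 𝒜 a]
    exact Ideal.sum_mem _ fun γ _ => h (Ideal.subset_span ⟨γ, rfl⟩)
  · intro h
    rw [homogeneousContent, Ideal.span_le]
    rintro _ ⟨γ, rfl⟩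
    exact hI γ h

theorem homogeneousContentIdeal_le_iff {f : R[X]} {I : Ideal R} (hI : I.IsHomogeneous 𝒜) :
    homogeneousContentIdeal 𝒜 f ≤ I ↔ f ∈ I.map (C : R →+* R[X]) := by
  rw [homogeneousContentIdeal, iSup_le_iff, Ideal.mem_map_C_iff]
  exact forall_congr' fun i => homogeneousContent_le_iff 𝒜 hI

theorem homogeneousContent_isHomogeneous (a : R) :
    (homogeneousContent 𝒜 a).IsHomogeneous 𝒜 := by
  apply Ideal.homogeneous_span
  rintro _ ⟨γ, rfl⟩
  exact ⟨γ, SetLike.coe_mem _⟩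

theorem homogeneousContentIdeal_isHomogeneous (f : R[X]) :
    (homogeneousContentIdeal 𝒜 f).IsHomogeneous 𝒜 :=
  Ideal.IsHomogeneous.iSup fun _ => homogeneousContent_isHomogeneous 𝒜 _

theorem homogeneousContentIdeal_fg (f : R[X]) : (homogeneousContentIdeal 𝒜 f).FG := by
  classical
  have h0 : homogeneousContent 𝒜 (0 : R) = ⊥ :=
    le_bot_iff.1 ((homogeneousContent_le_iff 𝒜 (Ideal.IsHomogeneous.bot 𝒜)).2 rfl)
  have h : homogeneousContentIdeal 𝒜 f =
      ⨆ i ∈ f.support, homogeneousContent 𝒜 (f.coeff i) := by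
    refine le_antisymm (iSup_le fun i => ?_) (iSup₂_le fun i _ => le_iSup_of_le i le_rfl)
    by_cases hi : f.coeff i = 0
    · rw [hi, h0]; exact bot_le
    · exact le_iSup₂_of_le i (mem_support_iff.2 hi) le_rfl
  rw [h]
  refine Submodule.fg_biSup _ _ fun i _ => ?_
  refine Submodule.fg_span (Set.Finite.subset
    ((((DirectSum.decompose 𝒜 (f.coeff i)).support.image
      fun γ => (DirectSum.decompose 𝒜 (f.coeff i) γ : R)) ∪ {0} : Finset R).finite_toSet) ?_)
  rintro _ ⟨γ, rfl⟩
  by_cases hγ : DirectSum.decompose 𝒜 (f.coeff i) γ = 0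
  · simp [hγ]
  · simp only [Finset.coe_union, Finset.coe_image]
    exact Or.inl ⟨γ, by simpa using hγ, rfl⟩

theorem homogeneousContentIdeal_ne_bot {f : R[X]} (hf : f ≠ 0) :
    homogeneousContentIdeal 𝒜 f ≠ ⊥ := by
  intro h
  have := (homogeneousContentIdeal_le_iff 𝒜 (Ideal.IsHomogeneous.bot 𝒜)).1 h.le
  rw [Ideal.map_bot] at this
  exact hf this

theorem homogeneousContentIdeal_one : homogeneousContentIdeal 𝒜 (1 : R[X]) = ⊤ := by
  rw [Ideal.eq_top_iff_one]
  have := (homogeneousContentIdeal_le_iff 𝒜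
    (homogeneousContentIdeal_isHomogeneous 𝒜 (1 : R[X]))).1 le_rfl
  simpa using (Ideal.mem_map_C_iff.1 this) 0

/-- A torsionless monoid embeds into a totally ordered group. -/
theorem exists_injective_toLex.{u} (Γ : Type u) [AddCancelCommMonoid Γ] [IsAddTorsionFree Γ] :
    ∃ (V : Type u) (_ : AddCommGroup V) (_ : LinearOrder V) (_ : IsOrderedAddMonoid V)
      (φ : Γ →+ V), Function.Injective φ := by
  classical
  let V₀ := DivisibleHull (Algebra.GrothendieckAddGroup Γ)
  let b := Module.Basis.ofVectorSpace ℚ V₀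
  let : LinearOrder (Module.Basis.ofVectorSpaceIndex ℚ V₀) := linearOrderOfSTO WellOrderingRel
  refine ⟨Lex (Module.Basis.ofVectorSpaceIndex ℚ V₀ →₀ ℚ), inferInstance, inferInstance,
    inferInstance, (AddMonoidHomClass.toAddMonoidHom b.repr).comp
      ((DivisibleHull.coeAddMonoidHom _).comp Algebra.GrothendieckAddGroup.of), ?_⟩
  intro x y h
  have h1 := DivisibleHull.coe_injective (b.repr.injective h)
  exact Algebra.GrothendieckAddGroup.of_injective h1

theorem le_radical_mul [IsAddTorsionFree Γ] (f g : R[X]) :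
    homogeneousContentIdeal 𝒜 f * homogeneousContentIdeal 𝒜 g ≤
      (homogeneousContentIdeal 𝒜 (f * g)).radical := by
  obtain ⟨V, _, _, _, φ, hφ⟩ := exists_injective_toLex Γ
  let lo : LinearOrder Γ := LinearOrder.lift' φ hφ
  have e : ‹DecidableEq Γ› = lo.toDecidableEq := Subsingleton.elim _ _
  subst e
  have : IsOrderedCancelAddMonoid Γ :=
    Function.Injective.isOrderedCancelAddMonoid φ (map_add φ) (fun {_ _} => Iff.rfl)
  rw [(homogeneousContentIdeal_isHomogeneous 𝒜 (f * g)).radical_eq]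
  refine le_sInf ?_
  rintro P ⟨hP, hle, hprime⟩
  rw [homogeneousContentIdeal_le_iff 𝒜 hP] at hle
  have : (P.map (C : R →+* R[X])).IsPrime := Ideal.isPrime_map_C_of_isPrime
  rcases this.mem_or_mem hle with h | h
  · exact Ideal.mul_le_left.trans ((homogeneousContentIdeal_le_iff 𝒜 hP).2 h)
  · exact Ideal.mul_le_right.trans ((homogeneousContentIdeal_le_iff 𝒜 hP).2 h)

section Nagata

variable {K : Type*} [Field K] [Algebra R K] [IsFractionRing R K]

/-- `N(⋆) = {f ∈ R[X] | f ≠ 0 and A_f^⋆ = R^⋆}`, a multiplicatively closed subset of `R[X]`. -/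
def nagataSubmonoid [IsAddTorsionFree Γ] [IsDomain R] (s : SemistarOperation R K) :
    Submonoid R[X] where
  carrier := {f | ∃ hf : f ≠ 0,
    s.star (nonzeroSubmoduleOfIdeal K (homogeneousContentIdeal 𝒜 f)
      (homogeneousContentIdeal_ne_bot 𝒜 hf)) = s.star (nonzeroSubmoduleSelf R K)}
  one_mem' := ⟨one_ne_zero, ((homogeneousContentIdeal_one 𝒜).symm ▸ StarDense.top s).2⟩
  mul_mem' := by
    rintro f g ⟨hf, hf'⟩ ⟨hg, hg'⟩
    refine ⟨mul_ne_zero hf hg, ?_⟩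
    have h : StarDense s (homogeneousContentIdeal 𝒜 f * homogeneousContentIdeal 𝒜 g) :=
      StarDense.mul ⟨_, hf'⟩ ⟨_, hg'⟩
    obtain ⟨n, hn⟩ := Ideal.exists_pow_le_of_le_radical_of_fg (le_radical_mul 𝒜 f g)
      ((homogeneousContentIdeal_fg 𝒜 f).mul (homogeneousContentIdeal_fg 𝒜 g))
    exact ((h.pow n).mono hn).2

/-- The Nagata ring `NA(R, ⋆) = R[X]_{N(⋆)}`. -/
abbrev NagataRing [IsAddTorsionFree Γ] [IsDomain R] (s : SemistarOperation R K) : Type _ :=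
  Localization (nagataSubmonoid 𝒜 s)

end Nagata

section HomogeneousQuotientField

/-- `H`: the multiplicative set of nonzero homogeneous elements of the domain `R`. -/
def nonzeroHomogeneous [IsDomain R] : Submonoid R :=
  SetLike.homogeneousSubmonoid 𝒜 ⊓ R⁰

/-- The homogeneous quotient field `R_H`, as an `R`-submodule of the quotient field `K`; its
elements are the fractions `a / h` with `a ∈ R` and `h ∈ H`. -/
noncomputable def homogeneousQuotientField (K : Type*) [Field K] [Algebra R K]
    [IsFractionRing R K] [IsDomain R] : Submodule R K :=
  Subalgebra.toSubmodule
    (Localization.subalgebra.ofField K (nonzeroHomogeneous 𝒜) inf_le_right)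

end HomogeneousQuotientField

end Graded

/-- `f₁ + f₂ X^(∂f₁ + 1) + ⋯ + fₙ X^(∂f₁ + ⋯ + ∂fₙ₋₁ + n - 1)`, where `∂fᵢ` is the degree of `fᵢ`
(and `∂0 = 0`). The index `i : Fin n` starts from `0`. -/
noncomputable def degreeShiftedSum {R : Type*} [CommRing R] {n : ℕ} (f : Fin n → R[X]) : R[X] :=
  ∑ i : Fin n, f i * X ^ ((∑ j ∈ Finset.univ.filter (fun j : Fin n => j < i), (f j).natDegree) + i)

/-! Write `F` for the degree-shifted sum. The shifts keep the summands from overlapping, so every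
coefficient of every `f i` is a coefficient of `F`, and no cancellation can shrink the content.

Two facts reduce the claim to a local computation. A maximal ideal `M` of the Nagata ring contracts
to `Q[X]` with `Q` a prime of `R` (`exists_under_eq_map_C`). Invertibility of `A` provides an index
`i` and polynomials `g j` with `g i ∉ Q[X]` and `g i * f j = g j * f i`
(`exists_relations_of_isUnit`).

Let `G` be the sum of the `g j` with the same shifts as in `F`. Then `g i * F = G * f i` and `G * f
j = g j * F`. If `G` were in `Q[X]`, the coefficients of `g i * F` would lie in `Q` times the
content of `F`, which Nakayama's lemma at `Q` forbids (`exists_coeff_mul_notMem`). So `G` is a unit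
at `M`, and `F` divides each `f j` there. As this holds at every `M`, `F` generates `A`. -/

/-! ### Coefficients of degree-shifted sums. -/

theorem coeff_degreeShiftedSum {R : Type*} [CommRing R] {n : ℕ} (f : Fin n → R[X]) (i : Fin n)
    {k : ℕ} (hk : k ≤ (f i).natDegree) :
    (degreeShiftedSum f).coeff
      (k + ((∑ j ∈ Finset.univ.filter (fun j : Fin n => j < i), (f j).natDegree) + i)) =
      (f i).coeff k := by
  -- The block of exponents occupied by `f a` ends before that of `f b` begins; the summand `+ i` in
  -- the exponents makes the inequality strict.
  have step : ∀ {a b : Fin n}, a < b →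
      (∑ j ∈ Finset.univ.filter (fun j : Fin n => j < a), (f j).natDegree) + a +
        (f a).natDegree <
      (∑ j ∈ Finset.univ.filter (fun j : Fin n => j < b), (f j).natDegree) + b := by
    intro a b hab
    have h : (∑ j ∈ insert a (Finset.univ.filter (fun j : Fin n => j < a)), (f j).natDegree) ≤
        ∑ j ∈ Finset.univ.filter (fun j : Fin n => j < b), (f j).natDegree := by
      refine Finset.sum_le_sum_of_subset fun j hj => ?_
      simp only [Finset.mem_insert, Finset.mem_filter, Finset.mem_univ, true_and] at hj ⊢
      rcases hj with rfl | hj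
      · exact hab
      · exact hj.trans hab
    rw [Finset.sum_insert (by simp)] at h
    have : (a : ℕ) < b := hab
    omega
  rw [degreeShiftedSum, finsetSum_coeff, Finset.sum_eq_single_of_mem i (Finset.mem_univ i)]
  · rw [coeff_mul_X_pow]
  · intro j _ hj
    rw [coeff_mul_X_pow']
    split_ifs with h
    · rcases lt_or_gt_of_ne hj with hji | hij
      · exact coeff_eq_zero_of_natDegree_lt (by have := step hji; omega)
      · have := step hij
        omega
    · rfl

theorem contentIdeal_le_contentIdeal_degreeShiftedSum {R : Type*} [CommRing R] {n : ℕ}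
    (f : Fin n → R[X]) (i : Fin n) :
    (f i).contentIdeal ≤ (degreeShiftedSum f).contentIdeal := by
  rw [contentIdeal_def, Ideal.span_le]
  intro x hx
  obtain ⟨k, hk, rfl⟩ := mem_coeffs_iff.1 hx
  rw [← coeff_degreeShiftedSum f i (le_natDegree_of_mem_supp k hk)]
  exact coeff_mem_contentIdeal _ _

/-! ### Content of a product, locally at a prime. -/

/-- If the coefficients of `w * f` lie in `Q * J`, where `J` contains those of `f`, then a power of
the first coefficient of `w` outside `Q` multiplies the coefficients of `f` into `Q * J`. -/
theorem pow_mul_coeff_mem {R : Type*} [CommRing R] {Q J : Ideal R} {w f : R[X]} {r : ℕ}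
    (hw : ∀ i < r, w.coeff i ∈ Q) (hf : ∀ i, f.coeff i ∈ J)
    (hwf : ∀ i, (w * f).coeff i ∈ Q * J) (k : ℕ) :
    w.coeff r ^ (k + 1) * f.coeff k ∈ Q * J := by
  induction k using Nat.strong_induction_on with
  | _ k ih =>
    -- In the coefficient of degree `r + k`, terms with `i < r` have `w.coeff i ∈ Q`, and those with
    -- `i > r` have `j < k`, so the factor `w.coeff r ^ k` brings them under the induction
    -- hypothesis. Only the term `(r, k)` remains.
    have h := Ideal.mul_mem_left _ (w.coeff r ^ k) (hwf (r + k))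
    rw [coeff_mul, Finset.mul_sum, ← Finset.add_sum_erase _ _
      (show (r, k) ∈ Finset.HasAntidiagonal.antidiagonal (r + k) by simp)] at h
    have h2 : ∑ x ∈ (Finset.HasAntidiagonal.antidiagonal (r + k)).erase (r, k),
        w.coeff r ^ k * (w.coeff x.1 * f.coeff x.2) ∈ Q * J := by
      refine Ideal.sum_mem _ ?_
      rintro ⟨i, j⟩ hij
      simp only [Finset.mem_erase, Finset.HasAntidiagonal.mem_antidiagonal, ne_eq, Prod.mk.injEq] at hij
      rcases lt_or_ge i r with hi | hi
      · exact Ideal.mul_mem_left _ _ (Ideal.mul_mem_mul (hw i hi) (hf j))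
      · have hj : j < k := by omega
        obtain ⟨m, rfl⟩ := Nat.exists_eq_add_of_lt hj
        have := Ideal.mul_mem_left _ (w.coeff r ^ m * w.coeff i) (ih j hj)
        convert this using 1
        ring
    convert (Ideal.add_mem_iff_left _ h2).1 h using 1
    ring

/-- Multiplying by a polynomial outside `Q[X]` does not push the coefficients of a nonzero
polynomial `f` into `Q` times the content ideal of `f`. -/
theorem exists_coeff_mul_notMem {R : Type*} [CommRing R] [IsDomain R] {Q : Ideal R} [Q.IsPrime]
    {w f : R[X]} (hw : w ∉ Q.map (C : R →+* R[X])) (hf : f ≠ 0) :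
    ∃ i, (w * f).coeff i ∉ Q * f.contentIdeal := by
  classical
  by_contra! hwf
  have hex : ∃ r, w.coeff r ∉ Q := by simpa [Ideal.mem_map_C_iff] using hw
  have key := pow_mul_coeff_mem (r := Nat.find hex)
    (fun i hi => not_not.1 (Nat.find_min hex hi)) (fun i => coeff_mem_contentIdeal f i) hwf
  have ha : w.coeff (Nat.find hex) ∉ Q := Nat.find_spec hex
  set a := w.coeff (Nat.find hex)
  let φ := algebraMap R (Localization.AtPrime Q)
  have hu : IsUnit (φ a) := IsLocalization.map_units _ (⟨a, ha⟩ : Q.primeCompl)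
  -- At `Q` the powers of `a` are units, so `key` puts the content of `f` inside `Q` times itself;
  -- it is finitely generated, and Nakayama applies.
  have h0 : f.contentIdeal.map φ = ⊥ := by
    refine Submodule.eq_bot_of_le_smul_of_le_jacobson_bot (Q.map φ) _
      (f.contentIdeal_FG.map _) ?_ ?_
    · rw [smul_eq_mul, ← Ideal.map_mul, Ideal.map_le_iff_le_comap, contentIdeal_def,
        Ideal.span_le]
      intro x hx
      obtain ⟨k, -, rfl⟩ := mem_coeffs_iff.1 hx
      have := Ideal.mem_map_of_mem φ (key k)
      rw [map_mul, map_pow] at this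
      exact (Ideal.unit_mul_mem_iff_mem _ (hu.pow _)).1 this
    · rw [IsLocalRing.jacobson_eq_maximalIdeal _ bot_ne_top, Localization.AtPrime.map_eq_maximalIdeal]
  rw [Ideal.map_eq_bot_iff_of_injective
    (IsLocalization.injective _ Q.primeCompl_le_nonZeroDivisors)] at h0
  exact hf ((contentIdeal_eq_bot_iff _).1 h0)

/-! ### Homogeneous content and the maximal ideals of the Nagata ring. -/

section Graded

variable {Γ R : Type*} [AddCancelCommMonoid Γ] [DecidableEq Γ] [CommRing R]
  (𝒜 : Γ → AddSubgroup R) [GradedRing 𝒜]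

theorem coeff_mem_homogeneousContentIdeal (f : R[X]) (k : ℕ) :
    f.coeff k ∈ homogeneousContentIdeal 𝒜 f :=
  Ideal.mem_map_C_iff.1 ((homogeneousContentIdeal_le_iff 𝒜
    (homogeneousContentIdeal_isHomogeneous 𝒜 f)).1 le_rfl) k

theorem homogeneousContentIdeal_le_degreeShiftedSum {n : ℕ} (f : Fin n → R[X]) (i : Fin n) :
    homogeneousContentIdeal 𝒜 (f i) ≤ homogeneousContentIdeal 𝒜 (degreeShiftedSum f) := by
  rw [homogeneousContentIdeal_le_iff 𝒜 (homogeneousContentIdeal_isHomogeneous 𝒜 _),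
    Ideal.mem_map_C_iff]
  intro k
  rcases le_or_gt k (f i).natDegree with hk | hk
  · rw [← coeff_degreeShiftedSum f i hk]
    exact coeff_mem_homogeneousContentIdeal 𝒜 _ _
  · rw [coeff_eq_zero_of_natDegree_lt hk]
    exact zero_mem _

theorem degreeShiftedSum_mem {n : ℕ} {f : Fin n → R[X]} {P : Ideal R[X]} (hf : ∀ i, f i ∈ P) :
    degreeShiftedSum f ∈ P :=
  Ideal.sum_mem _ fun i _ => P.mul_mem_right _ (hf i)

/-- The sum of the homogeneous content ideals of the elements of `P`. -/
def homogeneousContentSup (P : Ideal R[X]) : Ideal R :=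
  ⨆ f : P, homogeneousContentIdeal 𝒜 f.1

theorem le_map_homogeneousContentSup (P : Ideal R[X]) :
    P ≤ (homogeneousContentSup 𝒜 P).map (C : R →+* R[X]) := fun f hf =>
  Ideal.mem_map_C_iff.2 fun k => le_iSup (fun f : P => homogeneousContentIdeal 𝒜 f.1) ⟨f, hf⟩
    (coeff_mem_homogeneousContentIdeal 𝒜 f k)

/-- The ideals `homogeneousContentIdeal 𝒜 g` with `g ∈ P` form a directed family, since the
degree-shifted sum of two elements of `P` is in `P` and its content contains both of theirs. The
content of `f` is finitely generated, hence compact, so a single member of the family already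
contains it. -/
theorem exists_homogeneousContentIdeal_le {P : Ideal R[X]} {f : R[X]}
    (hf : f ∈ (homogeneousContentSup 𝒜 P).map (C : R →+* R[X])) :
    ∃ g ∈ P, homogeneousContentIdeal 𝒜 f ≤ homogeneousContentIdeal 𝒜 g := by
  have hI : (homogeneousContentSup 𝒜 P).IsHomogeneous 𝒜 :=
    Ideal.IsHomogeneous.iSup fun f => homogeneousContentIdeal_isHomogeneous 𝒜 f.1
  have hdir : Directed (· ≤ ·) fun f : P => homogeneousContentIdeal 𝒜 f.1 := fun f g =>
    ⟨⟨degreeShiftedSum ![f.1, g.1], degreeShiftedSum_mem fun i => by fin_cases i <;> simp⟩,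
      homogeneousContentIdeal_le_degreeShiftedSum 𝒜 ![f.1, g.1] 0,
      homogeneousContentIdeal_le_degreeShiftedSum 𝒜 ![f.1, g.1] 1⟩
  have hle := (homogeneousContentIdeal_le_iff 𝒜 hI).2 hf
  have hc := (Submodule.fg_iff_compact _).1 (homogeneousContentIdeal_fg 𝒜 f)
  obtain ⟨g, hg⟩ := (CompleteLattice.isCompactElement_iff_le_of_directed_sSup_le _ _).1 hc
    (Set.range fun f : P => homogeneousContentIdeal 𝒜 f.1) (Set.range_nonempty _)
    hdir.directedOn_range hle
  obtain ⟨⟨g, rfl⟩, hfg⟩ := hg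
  exact ⟨g.1, g.2, hfg⟩

variable [IsAddTorsionFree Γ] [IsDomain R] {K : Type*} [Field K] [Algebra R K]
  [IsFractionRing R K] (s : SemistarOperation R K)

theorem nagataSubmonoid_le_nonZeroDivisors : nagataSubmonoid 𝒜 s ≤ R[X]⁰ := fun _ hf =>
  mem_nonZeroDivisors_of_ne_zero hf.1

/-- Maximal ideals of the Nagata ring are extended from `R`. -/
theorem exists_under_eq_map_C (M : Ideal (NagataRing 𝒜 s)) [hM : M.IsMaximal] :
    ∃ Q : Ideal R, Q.IsPrime ∧ M.under R[X] = Q.map (C : R →+* R[X]) := by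
  set P := M.under R[X] with hP
  set I := homogeneousContentSup 𝒜 P
  have hPI := le_map_homogeneousContentSup 𝒜 P
  have hPN : Disjoint (nagataSubmonoid 𝒜 s : Set R[X]) P :=
    (IsLocalization.disjoint_under_iff (nagataSubmonoid 𝒜 s) _ M).2 hM.ne_top
  -- Membership in `N(⋆)` depends only on the content and passes to nonzero polynomials of larger
  -- content, so an element of `N(⋆)` in `I[X]` would produce one in `P`.
  have hIN : Disjoint (nagataSubmonoid 𝒜 s : Set R[X]) (I.map (C : R →+* R[X])) := by
    rw [Set.disjoint_left] at hPN ⊢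
    rintro f ⟨hf0, hf⟩ hfI
    obtain ⟨g, hgP, hfg⟩ := exists_homogeneousContentIdeal_le 𝒜 hfI
    have hd : StarDense s (homogeneousContentIdeal 𝒜 g) :=
      StarDense.mono ⟨homogeneousContentIdeal_ne_bot 𝒜 hf0, hf⟩ hfg
    refine hPN ⟨?_, hd.2⟩ hgP
    rintro rfl
    refine homogeneousContentIdeal_ne_bot 𝒜 hf0 (le_bot_iff.1 (hfg.trans ?_))
    exact (homogeneousContentIdeal_le_iff 𝒜 (Ideal.IsHomogeneous.bot 𝒜)).2 (zero_mem _)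
  have hne : (I.map (C : R →+* R[X])).map (algebraMap R[X] (NagataRing 𝒜 s)) ≠ ⊤ :=
    (IsLocalization.map_algebraMap_ne_top_iff_disjoint (nagataSubmonoid 𝒜 s) _ _).2 hIN
  have hMP : M = P.map (algebraMap R[X] (NagataRing 𝒜 s)) :=
    (IsLocalization.map_under (nagataSubmonoid 𝒜 s) _ M).symm
  -- `I[X]` contains `P` and extends to a proper ideal, so maximality of `M` forces equality.
  have hMI : M = (I.map (C : R →+* R[X])).map (algebraMap R[X] (NagataRing 𝒜 s)) :=
    hM.eq_of_le hne (hMP.le.trans (Ideal.map_mono hPI))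
  have hPeq : P = I.map (C : R →+* R[X]) :=
    le_antisymm hPI (Ideal.map_le_iff_le_comap.1 hMI.ge)
  refine ⟨I, ?_, hPeq⟩
  have : (I.map (C : R →+* R[X])).IsPrime := hPeq ▸ (inferInstance : (M.under R[X]).IsPrime)
  exact (Ideal.isPrime_map_C_iff_isPrime I).1 this

/-! ### Invertible ideals of the Nagata ring. -/

/-- Locally at a maximal ideal, an invertible ideal is generated by one of its generators; the
relations can be written with polynomial coefficients. -/
theorem exists_relations_of_isUnit {n : ℕ} {f : Fin n → R[X]} {A : Ideal (NagataRing 𝒜 s)}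
    (hA : IsUnit (A : FractionalIdeal (NagataRing 𝒜 s)⁰ (FractionRing (NagataRing 𝒜 s))))
    (hf : A = Ideal.span (Set.range fun i => algebraMap R[X] (NagataRing 𝒜 s) (f i)))
    (M : Ideal (NagataRing 𝒜 s)) (hM : M ≠ ⊤) :
    ∃ (i : Fin n) (g : Fin n → R[X]), g i ∉ M.under R[X] ∧ ∀ j, g i * f j = g j * f i := by
  have hN := nagataSubmonoid_le_nonZeroDivisors 𝒜 s
  have hinj : Function.Injective (algebraMap R[X] (NagataRing 𝒜 s)) :=
    IsLocalization.injective _ hN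
  have : IsDomain (NagataRing 𝒜 s) := IsLocalization.isDomain_localization hN
  set F := FractionRing (NagataRing 𝒜 s)
  have hFinj : Function.Injective (algebraMap (NagataRing 𝒜 s) F) := IsFractionRing.injective _ _
  obtain ⟨B, hAB⟩ := hA.exists_right_inv
  have hmem : ∀ j, algebraMap R[X] (NagataRing 𝒜 s) (f j) ∈ A := fun j =>
    hf ▸ Ideal.subset_span ⟨j, rfl⟩
  have hint : ∀ b ∈ B, ∀ a ∈ A, ∃ c : NagataRing 𝒜 s,
      algebraMap _ F c = algebraMap _ F a * b := by
    intro b hb a ha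
    rw [← FractionalIdeal.mem_one_iff (NagataRing 𝒜 s)⁰, ← hAB]
    exact FractionalIdeal.mul_mem_mul (FractionalIdeal.mem_coeIdeal_of_mem _ ha) hb
  -- If every product of a generator of `A` with an element of `B` came from `M`, then `1 = A * B ≤
  -- M`.
  obtain ⟨b, hb, i, hi⟩ : ∃ b ∈ B, ∃ i, ∀ c ∈ M,
      algebraMap _ F c ≠ algebraMap _ F (algebraMap R[X] (NagataRing 𝒜 s) (f i)) * b := by
    by_contra! hcon
    have hle : (A : FractionalIdeal (NagataRing 𝒜 s)⁰ F) * B ≤ M := by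
      refine FractionalIdeal.mul_le.2 ?_
      intro x hx b hb
      obtain ⟨a, ha, rfl⟩ := (FractionalIdeal.mem_coeIdeal _).1 hx
      rw [hf] at ha
      induction ha using Submodule.span_induction with
      | mem x h =>
        obtain ⟨i, rfl⟩ := h
        obtain ⟨c, hc, h⟩ := hcon b hb i
        rw [← h]
        exact FractionalIdeal.mem_coeIdeal_of_mem _ hc
      | zero => simp
      | add x y _ _ h1 h2 =>
        rw [map_add, add_mul]
        exact Submodule.add_mem (M : FractionalIdeal (NagataRing 𝒜 s)⁰ F).1
          (h1 (FractionalIdeal.mem_coeIdeal_of_mem _ (by rw [hf]; assumption)))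
          (h2 (FractionalIdeal.mem_coeIdeal_of_mem _ (by rw [hf]; assumption)))
      | smul r x _ h1 =>
        rw [smul_eq_mul, map_mul, mul_assoc, ← Algebra.smul_def]
        exact Submodule.smul_mem (M : FractionalIdeal (NagataRing 𝒜 s)⁰ F).1 _
          (h1 (FractionalIdeal.mem_coeIdeal_of_mem _ (by rw [hf]; assumption)))
    rw [hAB, ← FractionalIdeal.coeIdeal_top, FractionalIdeal.coeIdeal_le_coeIdeal F] at hle
    exact hM (top_le_iff.1 hle)
  -- The elements `c j = f j * b` satisfy `c i * f j = c j * f i`; a common denominator `d`, a unit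
  -- of the Nagata ring, turns them into the polynomials `g j` without affecting membership in `M`.
  choose c hc using fun j => hint b hb _ (hmem j)
  obtain ⟨d, hd⟩ := IsLocalization.exist_integer_multiples_of_finite (nagataSubmonoid 𝒜 s) c
  choose g hg using hd
  refine ⟨i, g, fun hgi => hi (c i) ?_ (hc i), fun j => ?_⟩
  · have h : algebraMap R[X] (NagataRing 𝒜 s) (g i) ∈ M := hgi
    rw [hg i, Algebra.smul_def] at h
    exact (Ideal.unit_mul_mem_iff_mem _ (IsLocalization.map_units _ d)).1 h
  · apply hinj
    rw [map_mul, map_mul, hg, hg, smul_mul_assoc, smul_mul_assoc]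
    congr 1
    apply hFinj
    rw [map_mul, map_mul, hc, hc]
    ring

/-- An invertible ideal of the Nagata ring generated by polynomials `f₁, …, fₙ` is generated by
their degree-shifted sum. -/
theorem eq_span_degreeShiftedSum_of_isUnit {n : ℕ} {f : Fin n → R[X]}
    {A : Ideal (NagataRing 𝒜 s)}
    (hA : IsUnit (A : FractionalIdeal (NagataRing 𝒜 s)⁰ (FractionRing (NagataRing 𝒜 s))))
    (hf : A = Ideal.span (Set.range fun i => algebraMap R[X] (NagataRing 𝒜 s) (f i))) :
    A = Ideal.span {algebraMap R[X] (NagataRing 𝒜 s) (degreeShiftedSum f)} := by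
  have hmem : ∀ j, f j ∈ A.under R[X] := fun j =>
    Ideal.mem_comap.2 (hf ▸ Ideal.subset_span ⟨j, rfl⟩)
  refine le_antisymm ?_ ((Ideal.span_singleton_le_iff_mem _).2 (degreeShiftedSum_mem hmem))
  conv_lhs => rw [hf]
  rw [Ideal.span_le]
  rintro _ ⟨j, rfl⟩
  set φ := algebraMap R[X] (NagataRing 𝒜 s)
  -- `D` is the colon ideal of the multipliers taking `f j` into the ideal generated by the shifted
  -- sum. It will be shown to lie in no maximal ideal.
  set D : Ideal (NagataRing 𝒜 s) :=
    Submodule.comap (LinearMap.mulRight (NagataRing 𝒜 s) (φ (f j)))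
      (Ideal.span {φ (degreeShiftedSum f)})
    with hD
  suffices h : D = ⊤ by
    have h1 : (1 : NagataRing 𝒜 s) ∈ D := h ▸ Submodule.mem_top
    simpa [hD] using h1
  by_contra hDtop
  obtain ⟨M, hM, hDM⟩ := Ideal.exists_le_maximal D hDtop
  obtain ⟨Q, hQ, hMQ⟩ := exists_under_eq_map_C 𝒜 s M
  obtain ⟨i, g, hgi, hgf⟩ := exists_relations_of_isUnit 𝒜 s hA hf M hM.ne_top
  -- The exponents are those of the `f k`, not of the `g k`, so that the relations can be summed
  -- termwise.
  set G := ∑ j : Fin n,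
    g j * X ^ ((∑ k ∈ Finset.univ.filter (fun k : Fin n => k < j), (f k).natDegree) + j)
  have hG : g i * degreeShiftedSum f = G * f i := by
    rw [degreeShiftedSum, Finset.mul_sum, Finset.sum_mul]
    refine Finset.sum_congr rfl fun j _ => ?_
    rw [← mul_assoc, hgf]
    ring
  have hgi0 : g i ≠ 0 := by
    intro h
    rw [h] at hgi
    exact hgi (zero_mem _)
  have hf0 : degreeShiftedSum f ≠ 0 := by
    intro h0
    have hj : f j = 0 := by
      rw [← contentIdeal_eq_bot_iff, ← le_bot_iff, ← contentIdeal_zero (R := R), ← h0]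
      exact contentIdeal_le_contentIdeal_degreeShiftedSum f j
    refine hDtop ((Ideal.eq_top_iff_one _).2 ?_)
    simp [hD, hj]
  -- Otherwise `g i * degreeShiftedSum f = G * f i` has all its coefficients in `Q` times the
  -- content of the shifted sum, although `g i ∉ Q[X]`.
  have hGM : G ∉ Q.map (C : R →+* R[X]) := by
    intro hGQ
    rw [Ideal.mem_map_C_iff] at hGQ
    obtain ⟨k, hk⟩ := exists_coeff_mul_notMem (hMQ ▸ hgi) hf0
    refine hk ?_
    rw [hG, coeff_mul]
    exact Ideal.sum_mem _ fun x _ => Ideal.mul_mem_mul (hGQ _)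
      (contentIdeal_le_contentIdeal_degreeShiftedSum f i (coeff_mem_contentIdeal _ _))
  -- It remains to see that `G` maps into `D ≤ M`, which contradicts `hGM`.
  refine hGM (hMQ ▸ Ideal.mem_comap.2 (hDM ?_))
  have h : G * f j = g j * degreeShiftedSum f := by
    apply mul_left_cancel₀ hgi0
    rw [mul_left_comm, hgf, mul_left_comm (g i), hG]
    ring
  change φ G * φ (f j) ∈ Ideal.span {φ (degreeShiftedSum f)}
  rw [← map_mul, h, map_mul]
  exact Ideal.mul_mem_left _ _ (Ideal.mem_span_singleton_self _)

/-- Multiplying finitely many generators by a common denominator, which is a unit of `T`, changes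
neither the ideal nor their number. -/
theorem exists_eq_span_range_algebraMap {S T : Type*} [CommRing S] [CommRing T] [Algebra S T]
    (N : Submonoid S) [IsLocalization N T] {A : Ideal T} (hA : A.FG) :
    ∃ (n : ℕ) (f : Fin n → S), A = Ideal.span (Set.range fun i => algebraMap S T (f i)) := by
  obtain ⟨n, x, hx⟩ := Submodule.fg_iff_exists_fin_generating_family.1 hA
  obtain ⟨d, hd⟩ := IsLocalization.exist_integer_multiples_of_finite N x
  choose f hf using hd
  refine ⟨n, f, ?_⟩
  rw [← hx]
  have hu := IsLocalization.map_units T d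
  refine le_antisymm (Submodule.span_le.2 ?_) (Ideal.span_le.2 ?_)
  · rintro _ ⟨i, rfl⟩
    refine (Ideal.unit_mul_mem_iff_mem _ hu).1 ?_
    rw [← Algebra.smul_def, ← hf]
    exact Ideal.subset_span ⟨i, rfl⟩
  · rintro _ ⟨i, rfl⟩
    simp only [hf, Algebra.smul_def]
    exact Ideal.mul_mem_left _ _ (Submodule.subset_span ⟨i, rfl⟩)

end Graded

theorem mainTheorem4 {Γ R K : Type*} [AddCancelCommMonoid Γ] [IsAddTorsionFree Γ] [DecidableEq Γ]
    [CommRing R] [IsDomain R] (𝒜 : Γ → AddSubgroup R) [GradedRing 𝒜]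
    [Field K] [Algebra R K] [IsFractionRing R K] (s : SemistarOperation R K)
    (hs : (s.star (nonzeroSubmoduleSelf R K) : Submodule R K) < homogeneousQuotientField 𝒜 K)
    (A : Ideal (NagataRing 𝒜 s))
    (hA : IsUnit (A : FractionalIdeal (NagataRing 𝒜 s)⁰ (FractionRing (NagataRing 𝒜 s)))) :
    A.IsPrincipal ∧
      (∃ (n : ℕ) (f : Fin n → R[X]),
        A = Ideal.span (Set.range fun i => algebraMap R[X] (NagataRing 𝒜 s) (f i))) ∧
      ∀ (n : ℕ) (f : Fin n → R[X]),
        A = Ideal.span (Set.range fun i => algebraMap R[X] (NagataRing 𝒜 s) (f i)) →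
        A = Ideal.span {algebraMap R[X] (NagataRing 𝒜 s) (degreeShiftedSum f)} := by

  have hN := nagataSubmonoid_le_nonZeroDivisors 𝒜 s
  have : IsDomain (NagataRing 𝒜 s) := IsLocalization.isDomain_localization hN
  obtain ⟨n, f, hf⟩ := exists_eq_span_range_algebraMap (nagataSubmonoid 𝒜 s)
    (Ideal.fg_of_isUnit (IsFractionRing.injective _ _) A hA)
  exact ⟨⟨_, eq_span_degreeShiftedSum_of_isUnit 𝒜 s hA hf⟩, ⟨n, f, hf⟩,
    fun _ _ hg => eq_span_degreeShiftedSum_of_isUnit 𝒜 s hA hg⟩
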